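/- Let $n \ge 1$, let $B$ be an $n \times n$ real symmetric positive semidefinite matrix, and for a positive semidefinite matrix $A$ write $\|v\|_A := \langle A v, v\rangle^{1/2}$. Let $f : \mathbb{R}^n \to \mathbb{R}$ be differentiable, bounded from below, and 1-smooth with respect to $\|\cdot\|_B$, i.e. $$f(y) \le f(x) + \langle \nabla f(x), y - x\rangle + \tfrac12 \|y - x\|_B^2 \quad \text{for all } x, y \in \mathbb{R}^n.$$ Let $x_0 \in \mathbb{R}^n$ and $1 \le \tau \le \operatorname{Rank}(B)$. For a $\tau$-element set $S \subseteq \{1,\dots,n\}$, let $I_S$ consist of the columns of the $n \times n$ identity matrix $I$ with indices in $S$, and put $B_{S\times S} := I_S^T B I_S$ and $v_S := I_S^T v$. Let $S_0$ be a random $\tau$-element subset of $\{1,\dots,n\}$ distributed according to volume sampling $\operatorname{Vol}_\tau(B)$, i.e. for every $\tau$-element set $S$, $$\Pr(S_0 = S) = \frac{\det(B_{S\times S})}{\sum_{S'} \det(B_{S'\times S'})},$$ where the sum is over all $\tau$-element subsets $S'$ of $\{1,\dots,n\}$. (Some of the matrices $B_{S \times S}$ may be singular; these have probability zero.) Let $$x_1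 := x_0 - I_{S_0} (B_{S_0\times S_0})^{-1} \nabla f(x_0)_{S_0}.$$ Let $B = Q \operatorname{Diag}(\lambda_1, \dots, \lambda_n) Q^T$ be any spectral decomposition of $B$ with $Q$ orthogonal and $\lambda_1 \ge \dots \ge \lambda_n$, and let $$B_\tau := Q \operatorname{Diag}(\lambda_1, \dots, \lambda_\tau, \lambda_\tau, \dots, \lambda_\tau) Q^T + \Big(\sum_{i=\tau+1}^n \lambda_i\Big) I$$ be the $\tau$-coordinate approximation of $B$. Then $f(x_1) \le f(x_0)$ almost surely, $f(x_1)$ is integrable, and $$f(x_0) - \mathbb{E} f(x_1) \ge \tfrac12 \|\nabla f(x_0)\|_{(B_\tau)^{-1}}^2.$$ -/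

import Mathlib

open MeasureTheory

namespace RCDVS

noncomputable section

/-- The seminorm `‖v‖_B = ⟨B v, v⟩^{1/2}` induced by a positive semidefinite matrix `B`. -/
def matSeminorm {n : ℕ} (B : Matrix (Fin n) (Fin n) ℝ) (v : EuclideanSpace ℝ (Fin n)) : ℝ :=
  Real.sqrt (inner ℝ (WithLp.toLp 2 (B.mulVec v.ofLp)) v)

/-- The differentiable function `f` is 1-smooth with respect to the seminorm `‖·‖_B`:
`f y ≤ f x + ⟨∇f x, y - x⟩ + ½ ‖y - x‖_B²` for all `x, y`. -/
structure IsOneSmooth {n : ℕ} (f : EuclideanSpace ℝ (Fin n) → ℝ)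
    (B : Matrix (Fin n) (Fin n) ℝ) : Prop where
  differentiable : Differentiable ℝ f
  le_quadratic : ∀ x y : EuclideanSpace ℝ (Fin n),
    f y ≤ f x + inner ℝ (gradient f x) (y - x) + 1 / 2 * matSeminorm B (y - x) ^ 2

/-- The `τ`-element subsets of the `n` coordinates. -/
abbrev CoordSubset (n τ : ℕ) : Type := {S : Finset (Fin n) // S.card = τ}

/-- The matrix `I_S`: the columns of the identity matrix with indices in `S`. -/
def colSelect {n : ℕ} (S : Finset (Fin n)) : Matrix (Fin n) S ℝ :=
  (1 : Matrix (Fin n) (Fin n) ℝ).submatrix id Subtype.val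

/-- The principal submatrix `B_{S × S}`. -/
def principalSub {n : ℕ} (B : Matrix (Fin n) (Fin n) ℝ) (S : Finset (Fin n)) : Matrix S S ℝ :=
  B.submatrix Subtype.val Subtype.val

/-- The subvector `v_S`. -/
def subvec {n : ℕ} (v : EuclideanSpace ℝ (Fin n)) (S : Finset (Fin n)) : S → ℝ :=
  fun i => v i.val

/-- One step `x - I_S (B_{S × S})⁻¹ (∇f x)_S` of the block coordinate descent method. -/
def step {n : ℕ} (f : EuclideanSpace ℝ (Fin n) → ℝ) (B : Matrix (Fin n) (Fin n) ℝ)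
    (x : EuclideanSpace ℝ (Fin n)) (S : Finset (Fin n)) : EuclideanSpace ℝ (Fin n) :=
  x - WithLp.toLp 2
    ((colSelect S).mulVec ((principalSub B S)⁻¹.mulVec (subvec (gradient f x) S)))

/-- The random `τ`-element subset `S₀` is distributed according to `τ`-element volume sampling
with respect to `B`. The finite set of values carries the discrete σ-algebra. -/
structure IsVolumeSampling {n τ : ℕ} {Ω : Type*} [MeasurableSpace Ω] (μ : Measure Ω)
    (B : Matrix (Fin n) (Fin n) ℝ) (S₀ : Ω → CoordSubset n τ) : Prop where
  measurable : Measurable[_, ⊤] S₀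
  prob_eq : ∀ S : CoordSubset n τ, μ.real {ω | S₀ ω = S} =
    (principalSub B S.val).det / ∑ S' : CoordSubset n τ, (principalSub B S'.val).det

/-- `B = Q Diag(lam) Qᵀ` is a spectral decomposition with `Q` orthogonal and the eigenvalues
listed in non-increasing order. -/
structure IsSpectralDecomp {n : ℕ} (B Q : Matrix (Fin n) (Fin n) ℝ) (lam : Fin n → ℝ) :
    Prop where
  orthogonal : Q ∈ Matrix.orthogonalGroup (Fin n) ℝ
  antitone : Antitone lam
  eq : B = Q * Matrix.diagonal lam * Q.transpose

/-- Every real symmetric matrix has a spectral decomposition in the above sense. -/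
theorem exists_isSpectralDecomp {n : ℕ} {B : Matrix (Fin n) (Fin n) ℝ} (hB : B.IsHermitian) :
    ∃ Q lam, IsSpectralDecomp B Q lam := by
  let e : Fin n ≃ Fin n := (finCongr (Fintype.card_fin n).symm).trans
    (Fintype.equivOfCardEq (Fintype.card_fin _))
  let U : Matrix (Fin n) (Fin n) ℝ := hB.eigenvectorUnitary
  have hU : U * U.transpose = 1 :=
    (Matrix.mem_orthogonalGroup_iff (Fin n) ℝ).mp hB.eigenvectorUnitary.2
  have hspec : B = U * Matrix.diagonal hB.eigenvalues * U.transpose := by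
    have h := hB.spectral_theorem
    rw [Unitary.conjStarAlgAut_apply] at h
    exact h
  refine ⟨U.submatrix id e, hB.eigenvalues ∘ e, ?_, ?_, ?_⟩
  · rw [Matrix.mem_orthogonalGroup_iff]
    change U.submatrix id e * (U.submatrix id e).transpose = 1
    rw [Matrix.transpose_submatrix, Matrix.submatrix_mul_equiv, hU, Matrix.submatrix_id_id]
  · intro i j hij
    simp only [Function.comp_apply, Matrix.IsHermitian.eigenvalues]
    apply hB.eigenvalues₀_antitone
    simpa [e] using hij
  · rw [← Matrix.submatrix_diagonal_equiv, Matrix.transpose_submatrix,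
      Matrix.submatrix_mul_equiv, Matrix.submatrix_mul_equiv, Matrix.submatrix_id_id]
    exact hspec

/-- The `τ`-coordinate approximation
`Q Diag(λ₁, …, λ_τ, λ_τ, …, λ_τ) Qᵀ + (∑_{i > τ} λ_i) I` (for `τ ≥ 1`) of the matrix with spectral
decomposition `Q Diag(λ₁, …, λ_n) Qᵀ`. As `Fin n` starts at `0`, the eigenvalue written `λ_i` here
is `lam (i - 1)`. -/
def coordApprox {n : ℕ} (Q : Matrix (Fin n) (Fin n) ℝ) (lam : Fin n → ℝ) (τ : ℕ) :
    Matrix (Fin n) (Fin n) ℝ :=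
  Q * Matrix.diagonal
      (fun i : Fin n => lam ⟨min i.val (τ - 1), lt_of_le_of_lt (min_le_left _ _) i.isLt⟩) *
    Q.transpose +
  (∑ i : Fin n with τ ≤ i.val, lam i) • (1 : Matrix (Fin n) (Fin n) ℝ)

end

end RCDVS

/-! Write `g = ∇f x₀`. A step on the block `S` decreases `f` by at least half of
`⟨(B_{S × S})⁻¹ g_S, g_S⟩`. Bounded below, `f` cannot slope along `ker B`, so `g ⟂ ker B`; hence
`det B_{S × S} ⟨(B_{S × S})⁻¹ g_S, g_S⟩ = ⟨adj(B_{S × S}) g_S, g_S⟩`, also for singular blocks. By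
the matrix determinant lemma the right-hand side is the change of a principal minor under the
rank-one update `B + g gᵀ`. The sum of all `τ × τ` principal minors is a coefficient of
`det (1 + X B)`, so its change may be computed in an eigenbasis of `B`, where it equals
`∑ i, (Qᵀ g)_i² e_{τ-1}(λ without λ_i)`, with `e_k` the elementary symmetric polynomials. Dividing
by the normalizing constant `e_τ(λ)`, it remains to see that `e_τ(λ) ≤ c_i e_{τ-1}(λ without λ_i)`
for the eigenvalue `c_i` of `B_τ`. This `c_i` is the sum of `λ` over the indices `> τ` and
`min i τ`, a set which contains `i` and meets every `τ`-element set of indices: split one of its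
members, `i` if possible, off each monomial of `e_τ`. -/

namespace RCDVS

open Finset Matrix Polynomial

section PrincipalMinors

variable {m R : Type*} [Fintype m] [DecidableEq m] [CommRing R]

theorem det_add_vecMulVec (A : Matrix m m R) (u v : m → R) :
    (A + vecMulVec u v).det = A.det + v ⬝ᵥ (A.adjugate *ᵥ u) := by
  have hrow (s : Finset m) : (of fun i => if i ∈ s then A i + u i • v else A i).det =
      A.det + ∑ i ∈ s, u i * (A.updateRow i v).det := by
    induction s using Finset.induction_on with
    | empty => rw [sum_empty, add_zero]; rfl
    | insert i s hi ih =>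
      set M : Matrix m m R := of fun j => if j ∈ s then A j + u j • v else A j with hM
      have hinsert : (of fun j => if j ∈ insert i s then A j + u j • v else A j) =
          M.updateRow i (M i + u i • v) := by
        ext j l
        by_cases hj : j = i <;> simp [hM, hj, hi, updateRow_apply]
      -- Once row `i` is `v`, adding multiples of `v` to the other rows changes nothing.
      have hupdate : (M.updateRow i v).det = (A.updateRow i v).det := by
        refine det_eq_of_forall_row_eq_smul_add_const (fun j => if j ∈ s then u j else 0) i
          (if_neg hi) fun j l => ?_
        by_cases hj : j = i <;> by_cases hjs : j ∈ s <;> simp_all [updateRow_apply]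
      rw [hinsert, det_updateRow_add, updateRow_eq_self, det_updateRow_smul, hupdate, ih,
        sum_insert hi]
      ring
  have hadj : v ⬝ᵥ (A.adjugate *ᵥ u) = ∑ i, u i * (A.updateRow i v).det := by
    rw [dotProduct_mulVec, ← mulVec_transpose, adjugate_transpose, ← cramer_eq_adjugate_mulVec,
      dotProduct_comm]
    simp only [dotProduct, cramer_transpose_apply]
  rw [hadj, ← hrow univ]
  congr 1
  ext i j
  simp [vecMulVec_apply]

theorem dotProduct_adjugate_diagonal_mulVec (d u v : m → R) :
    v ⬝ᵥ ((diagonal d).adjugate *ᵥ u) = ∑ i, v i * u i * ∏ j ∈ univ.erase i, d j := by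
  rw [adjugate_diagonal]
  exact sum_congr rfl fun i _ => by rw [mulVec_diagonal]; ring

theorem det_mul_dotProduct_inv_mulVec {K : Type*} [Field K] (M : Matrix m m K) (u v : m → K)
    (hv : ∀ w, M *ᵥ w = 0 → v ⬝ᵥ w = 0) :
    M.det * (v ⬝ᵥ (M⁻¹ *ᵥ u)) = v ⬝ᵥ (M.adjugate *ᵥ u) := by
  by_cases hM : M.det = 0
  · have hker : M *ᵥ (M.adjugate *ᵥ u) = 0 := by
      rw [mulVec_mulVec, mul_adjugate, hM, zero_smul, zero_mulVec]
    rw [hM, zero_mul, hv _ hker]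
  · rw [Matrix.inv_def, smul_mulVec, dotProduct_smul, smul_eq_mul, Ring.inverse_eq_inv',
      mul_inv_cancel_left₀ hM]

/-- The sum of all `k × k` principal minors of `M`. For `M = B` and `k = τ` it is the normalizing
constant of `τ`-element volume sampling. -/
def sumPrincipalMinors (M : Matrix m m R) (k : ℕ) : R :=
  ∑ s ∈ univ.powersetCard k, (M.submatrix (Subtype.val : s → m) Subtype.val).det

theorem sumPrincipalMinors_mul_comm {l : Type*} [Fintype l] [DecidableEq l] (A : Matrix m l R)
    (B : Matrix l m R) (k : ℕ) :
    sumPrincipalMinors (A * B) k = sumPrincipalMinors (B * A) k := by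
  rw [sumPrincipalMinors, sumPrincipalMinors, ← coeff_det_one_add_X_smul_eq_sum_minors,
    ← coeff_det_one_add_X_smul_eq_sum_minors, Matrix.map_mul, Matrix.map_mul, ← Matrix.smul_mul,
    det_one_add_mul_comm, Matrix.mul_smul]

theorem sumPrincipalMinors_conj {P Q : Matrix m m R} (hQP : Q * P = 1) (M : Matrix m m R) (k : ℕ) :
    sumPrincipalMinors (P * M * Q) k = sumPrincipalMinors M k := by
  rw [Matrix.mul_assoc, sumPrincipalMinors_mul_comm, Matrix.mul_assoc, hQP, Matrix.mul_one]

theorem sumPrincipalMinors_diagonal (d : m → R) (k : ℕ) :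
    sumPrincipalMinors (diagonal d) k = (univ.val.map d).esymm k := by
  rw [esymm_map_val]
  refine sum_congr rfl fun s _ => ?_
  rw [submatrix_diagonal _ _ Subtype.val_injective, det_diagonal]
  exact prod_coe_sort s d

theorem sumPrincipalMinors_add_vecMulVec (M : Matrix m m R) (u v : m → R) (k : ℕ) :
    sumPrincipalMinors (M + vecMulVec u v) k = sumPrincipalMinors M k +
      ∑ s ∈ univ.powersetCard k, (fun i : s => v i) ⬝ᵥ
        ((M.submatrix Subtype.val Subtype.val).adjugate *ᵥ fun i : s => u i) := by
  rw [sumPrincipalMinors, sumPrincipalMinors, ← sum_add_distrib]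
  exact sum_congr rfl fun s _ => det_add_vecMulVec _ _ _

theorem sum_powersetCard_succ_sum_erase {ι M : Type*} [DecidableEq ι] [AddCommMonoid M]
    (U : Finset ι) (k : ℕ) (F : ι → Finset ι → M) :
    ∑ T ∈ U.powersetCard (k + 1), ∑ i ∈ T, F i (T.erase i) =
      ∑ i ∈ U, ∑ T ∈ (U.erase i).powersetCard k, F i T := by
  rw [sum_sigma', sum_sigma']
  refine sum_nbij' (fun p => ⟨p.2, p.1.erase p.2⟩) (fun p => ⟨insert p.1 p.2, p.1⟩)
    ?_ ?_ ?_ ?_ fun _ _ => rfl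
  all_goals simp only [mem_sigma, mem_powersetCard, and_imp, Sigma.forall]
  · intro T i hTU hT hi
    exact ⟨hTU hi, erase_subset_erase i hTU, by rw [card_erase_of_mem hi, hT, Nat.add_sub_cancel]⟩
  · intro i T hi hTU hT
    have hiT : i ∉ T := fun h => notMem_erase i U (hTU h)
    exact ⟨⟨insert_subset hi (hTU.trans (erase_subset i U)), by rw [card_insert_of_notMem hiT, hT]⟩,
      mem_insert_self i T⟩
  · intro T i _ _ hi
    rw [insert_erase hi]
  · intro i T _ hTU _
    rw [erase_insert fun h => notMem_erase i U (hTU h)]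

theorem sum_dotProduct_adjugate_diagonal (d u v : m → R) (k : ℕ) :
    ∑ s ∈ univ.powersetCard (k + 1), (fun i : s => v i) ⬝ᵥ
        (((diagonal d).submatrix Subtype.val Subtype.val).adjugate *ᵥ fun i : s => u i) =
      ∑ i, v i * u i * ((univ.erase i).val.map d).esymm k := by
  have hminor (s : Finset m) : (fun i : s => v i) ⬝ᵥ
        (((diagonal d).submatrix Subtype.val Subtype.val).adjugate *ᵥ fun i : s => u i) =
      ∑ i ∈ s, v i * u i * ∏ j ∈ s.erase i, d j := by
    rw [submatrix_diagonal _ _ Subtype.val_injective, dotProduct_adjugate_diagonal_mulVec,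
      ← sum_coe_sort s]
    refine sum_congr rfl fun i _ => ?_
    have herase : (univ.erase i).image Subtype.val = s.erase i.val := by
      rw [image_erase Subtype.val_injective, univ_eq_attach, attach_image_val]
    rw [← herase, prod_image Subtype.val_injective.injOn]
    rfl
  simp only [hminor, esymm_map_val, mul_sum]
  exact sum_powersetCard_succ_sum_erase univ k fun i T => v i * u i * ∏ j ∈ T, d j

theorem sum_dotProduct_adjugate_conj_diagonal {P Q : Matrix m m R} (hPQ : P * Q = 1)
    (d u v : m → R) (k : ℕ) :
    ∑ s ∈ univ.powersetCard (k + 1), (fun i : s => v i) ⬝ᵥ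
        (((P * diagonal d * Q).submatrix Subtype.val Subtype.val).adjugate *ᵥ fun i : s => u i) =
      ∑ i, (v ᵥ* P) i * (Q *ᵥ u) i * ((univ.erase i).val.map d).esymm k := by
  have hQP : Q * P = 1 := mul_eq_one_comm.mp hPQ
  have hconj : P * diagonal d * Q + vecMulVec u v =
      P * (diagonal d + vecMulVec (Q *ᵥ u) (v ᵥ* P)) * Q := by
    rw [Matrix.mul_add, Matrix.add_mul, mul_vecMulVec, vecMulVec_mul, mulVec_mulVec,
      vecMul_vecMul, hPQ, one_mulVec, vecMul_one]
  have h := sumPrincipalMinors_add_vecMulVec (P * diagonal d * Q) u v (k + 1)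
  rw [hconj, sumPrincipalMinors_conj hQP, sumPrincipalMinors_conj hQP,
    sumPrincipalMinors_add_vecMulVec, add_right_inj] at h
  rw [← h, sum_dotProduct_adjugate_diagonal]

end PrincipalMinors

section ElementarySymmetric

theorem esymm_succ_le {ι R : Type*} [DecidableEq ι] [CommSemiring R] [PartialOrder R]
    [IsOrderedRing R] {a : ι → R} (ha : ∀ i, 0 ≤ a i) (U : Finset ι) {K : Finset ι} {k : ℕ}
    (hK : #(U \ K) ≤ k) {i : ι} (hi : i ∈ K) :
    (U.val.map a).esymm (k + 1) ≤ (∑ j ∈ K, a j) * ((U.erase i).val.map a).esymm k := by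
  -- Splitting off `i` itself whenever `i ∈ T` is what keeps the remainder inside `U.erase i`.
  have hselect (T) (hT : T ∈ U.powersetCard (k + 1)) : ∃ j ∈ T, j ∈ K ∧ i ∉ T.erase j := by
    obtain ⟨hTU, hcard⟩ := mem_powersetCard.mp hT
    by_cases hiT : i ∈ T
    · exact ⟨i, hiT, hi, notMem_erase i T⟩
    · obtain ⟨j, hjT, hj⟩ := exists_mem_notMem_of_card_lt_card (by omega : #(U \ K) < #T)
      exact ⟨j, hjT, by_contra fun hjK => hj (mem_sdiff.mpr ⟨hTU hjT, hjK⟩),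
        fun h => hiT (mem_of_mem_erase h)⟩
  have : Nonempty ι := ⟨i⟩
  choose! s hsT hsK his using hselect
  let split (T : Finset ι) : ι × Finset ι := (s T, T.erase (s T))
  have hinj : Set.InjOn split (U.powersetCard (k + 1)) := by
    intro T hT T' hT' h
    obtain ⟨hs, herase⟩ := Prod.mk.inj h
    rw [← insert_erase (hsT T hT), ← insert_erase (hsT T' hT'), herase, hs]
  have hmaps : (U.powersetCard (k + 1)).image split ⊆ K ×ˢ (U.erase i).powersetCard k := by
    refine image_subset_iff.mpr fun T hT => mk_mem_product (hsK T hT) ?_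
    obtain ⟨hTU, hcard⟩ := mem_powersetCard.mp hT
    exact mem_powersetCard.mpr
      ⟨subset_erase.mpr ⟨(erase_subset _ T).trans hTU, his T hT⟩,
        by rw [card_erase_of_mem (hsT T hT), hcard, Nat.add_sub_cancel]⟩
  rw [esymm_map_val, esymm_map_val, sum_mul_sum, ← sum_product']
  calc ∑ T ∈ U.powersetCard (k + 1), ∏ l ∈ T, a l
      = ∑ p ∈ (U.powersetCard (k + 1)).image split, a p.1 * ∏ l ∈ p.2, a l := by
        rw [sum_image hinj]
        exact sum_congr rfl fun T hT => (mul_prod_erase T a (hsT T hT)).symm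
    _ ≤ ∑ p ∈ K ×ˢ (U.erase i).powersetCard k, a p.1 * ∏ l ∈ p.2, a l :=
        sum_le_sum_of_subset_of_nonneg hmaps fun p _ _ =>
          mul_nonneg (ha _) (prod_nonneg fun l _ => ha l)

end ElementarySymmetric

section BlockStep

variable {n : ℕ} {f : EuclideanSpace ℝ (Fin n) → ℝ} {B : Matrix (Fin n) (Fin n) ℝ}

theorem matSeminorm_sq {A : Matrix (Fin n) (Fin n) ℝ} (hA : A.PosSemidef)
    (v : EuclideanSpace ℝ (Fin n)) : matSeminorm A v ^ 2 = v.ofLp ⬝ᵥ (A *ᵥ v.ofLp) := by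
  rw [matSeminorm, EuclideanSpace.inner_eq_star_dotProduct, star_trivial, Real.sq_sqrt]
  simpa using hA.dotProduct_mulVec_nonneg v.ofLp

theorem IsOneSmooth.le_add (hf : IsOneSmooth f B) (hB : B.PosSemidef)
    (x : EuclideanSpace ℝ (Fin n)) (v : Fin n → ℝ) :
    f (x + WithLp.toLp 2 v) ≤
      f x + (gradient f x).ofLp ⬝ᵥ v + 1 / 2 * (v ⬝ᵥ (B *ᵥ v)) := by
  have h := hf.le_quadratic x (x + WithLp.toLp 2 v)
  rwa [add_sub_cancel_left, matSeminorm_sq hB, EuclideanSpace.inner_eq_star_dotProduct,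
    star_trivial, dotProduct_comm] at h

theorem IsOneSmooth.gradient_dotProduct_eq_zero (hf : IsOneSmooth f B) (hB : B.PosSemidef)
    (hbdd : BddBelow (Set.range f)) (x : EuclideanSpace ℝ (Fin n)) {v : Fin n → ℝ}
    (hv : B *ᵥ v = 0) : (gradient f x).ofLp ⬝ᵥ v = 0 := by
  obtain ⟨c, hc⟩ := hbdd
  by_contra hne
  set t := (c - f x - 1) / ((gradient f x).ofLp ⬝ᵥ v)
  have hupper : f (x + WithLp.toLp 2 (t • v)) ≤ c - 1 := by
    have h := hf.le_add hB x (t • v)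
    rw [mulVec_smul, hv, smul_zero, dotProduct_zero, dotProduct_smul, smul_eq_mul,
      div_mul_cancel₀ _ hne] at h
    linarith
  linarith [hc (Set.mem_range_self (x + WithLp.toLp 2 (t • v)))]

theorem dotProduct_colSelect_mulVec (v : EuclideanSpace ℝ (Fin n)) (S : Finset (Fin n))
    (w : S → ℝ) : v.ofLp ⬝ᵥ (colSelect S *ᵥ w) = subvec v S ⬝ᵥ w := by
  have hsubvec : v.ofLp ᵥ* colSelect S = subvec v S := by
    ext i
    simp [subvec, colSelect, vecMul, dotProduct, Matrix.one_apply]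
  rw [dotProduct_mulVec, hsubvec]

theorem colSelect_mulVec_dotProduct_mulVec (B : Matrix (Fin n) (Fin n) ℝ) (S : Finset (Fin n))
    (w : S → ℝ) :
    (colSelect S *ᵥ w) ⬝ᵥ (B *ᵥ (colSelect S *ᵥ w)) = w ⬝ᵥ (principalSub B S *ᵥ w) := by
  have hprincipal : principalSub B S = (colSelect S)ᵀ * B * colSelect S := by
    ext i j
    simp [principalSub, colSelect, Matrix.mul_apply, Matrix.one_apply]
  rw [hprincipal, ← mulVec_mulVec, ← mulVec_mulVec, dotProduct_mulVec w, vecMul_transpose]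

theorem subvec_dotProduct_eq_zero (hB : B.PosSemidef) {g : EuclideanSpace ℝ (Fin n)}
    (hg : ∀ v, B *ᵥ v = 0 → g.ofLp ⬝ᵥ v = 0) (S : Finset (Fin n)) (w : S → ℝ)
    (hw : principalSub B S *ᵥ w = 0) : subvec g S ⬝ᵥ w = 0 := by
  rw [← dotProduct_colSelect_mulVec]
  apply hg
  rw [← hB.dotProduct_mulVec_zero_iff, star_trivial, colSelect_mulVec_dotProduct_mulVec, hw,
    dotProduct_zero]

/-- The squared Newton decrement `⟨(B_{S × S})⁻¹ g_S, g_S⟩`: twice the decrease of the objective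
guaranteed by a step on the coordinates in `S` from a point with gradient `g`. It is `0` when
`B_{S × S}` is singular, since the inverse is then `0`. -/
noncomputable def blockDecrementSq (B : Matrix (Fin n) (Fin n) ℝ) (g : EuclideanSpace ℝ (Fin n))
    (S : Finset (Fin n)) : ℝ :=
  subvec g S ⬝ᵥ ((principalSub B S)⁻¹ *ᵥ subvec g S)

theorem blockDecrementSq_nonneg (hB : B.PosSemidef) (g : EuclideanSpace ℝ (Fin n))
    (S : Finset (Fin n)) : 0 ≤ blockDecrementSq B g S :=
  (hB.submatrix Subtype.val).inv.dotProduct_mulVec_nonneg (subvec g S)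

theorem IsOneSmooth.step_le (hf : IsOneSmooth f B) (hB : B.PosSemidef)
    (x : EuclideanSpace ℝ (Fin n)) (S : Finset (Fin n)) :
    f (step f B x S) ≤ f x - 1 / 2 * blockDecrementSq B (gradient f x) S := by
  set w := (principalSub B S)⁻¹ *ᵥ subvec (gradient f x) S with hw
  have hquad : w ⬝ᵥ (principalSub B S *ᵥ w) = blockDecrementSq B (gradient f x) S := by
    by_cases hdet : IsUnit (principalSub B S).det
    · rw [hw, mulVec_mulVec _ (principalSub B S), mul_nonsing_inv _ hdet, one_mulVec,
        dotProduct_comm, blockDecrementSq]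
    · simp [hw, blockDecrementSq, nonsing_inv_apply_not_isUnit _ hdet]
  have h := hf.le_add hB x (-(colSelect S *ᵥ w))
  rw [mulVec_neg, neg_dotProduct_neg, dotProduct_neg, colSelect_mulVec_dotProduct_mulVec, hquad,
    dotProduct_colSelect_mulVec, WithLp.toLp_neg, ← sub_eq_add_neg] at h
  calc f (step f B x S)
      ≤ f x + -blockDecrementSq B (gradient f x) S
          + 1 / 2 * blockDecrementSq B (gradient f x) S := h
    _ = f x - 1 / 2 * blockDecrementSq B (gradient f x) S := by ring

end BlockStep

section SpectralDecomposition

variable {n : ℕ} {B Q : Matrix (Fin n) (Fin n) ℝ} {lam : Fin n → ℝ}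

theorem nonneg_of_posSemidef_conj_diagonal (hB : (Q * diagonal lam * Qᵀ).PosSemidef)
    (hQ : Q * Qᵀ = 1) (i : Fin n) : 0 ≤ lam i :=
  posSemidef_diagonal_iff.mp
    ((IsUnit.of_mul_eq_one _ hQ).posSemidef_star_right_conjugate_iff.mp hB) i

/-- The `i`-th eigenvalue of the `τ`-coordinate approximation `coordApprox Q lam τ`. -/
def coordApproxEigenvalue (lam : Fin n → ℝ) (τ : ℕ) (i : Fin n) : ℝ :=
  lam ⟨min i.val (τ - 1), lt_of_le_of_lt (min_le_left _ _) i.isLt⟩ +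
    ∑ j : Fin n with τ ≤ j.val, lam j

theorem coordApproxEigenvalue_nonneg (hlam : ∀ i, 0 ≤ lam i) (τ : ℕ) (i : Fin n) :
    0 ≤ coordApproxEigenvalue lam τ i :=
  add_nonneg (hlam _) (sum_nonneg fun j _ => hlam j)

theorem coordApprox_eq_conj_diagonal (hQ : Q * Qᵀ = 1) (lam : Fin n → ℝ) (τ : ℕ) :
    coordApprox Q lam τ = Q * diagonal (coordApproxEigenvalue lam τ) * Qᵀ := by
  unfold coordApproxEigenvalue
  rw [← diagonal_add, ← smul_one_eq_diagonal, Matrix.mul_add, Matrix.add_mul,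
    Matrix.mul_smul, Matrix.smul_mul, Matrix.mul_one, hQ, coordApprox]

theorem coordApprox_inv (hQ : Q * Qᵀ = 1) {τ : ℕ} (hpos : ∀ i, coordApproxEigenvalue lam τ i ≠ 0) :
    (coordApprox Q lam τ)⁻¹ =
      Q * diagonal (fun i => (coordApproxEigenvalue lam τ i)⁻¹) * Qᵀ := by
  have hdiag : diagonal (coordApproxEigenvalue lam τ) *
      diagonal (fun i => (coordApproxEigenvalue lam τ i)⁻¹) = 1 := by
    rw [diagonal_mul_diagonal, ← diagonal_one]
    exact congrArg diagonal (funext fun i => mul_inv_cancel₀ (hpos i))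
  rw [coordApprox_eq_conj_diagonal hQ, Matrix.mul_inv_rev, Matrix.mul_inv_rev,
    inv_eq_right_inv hdiag, inv_eq_right_inv hQ, inv_eq_left_inv hQ, Matrix.mul_assoc]

theorem matSeminorm_coordApprox_inv_sq (hQ : Q * Qᵀ = 1) {τ : ℕ}
    (hpos : ∀ i, 0 < coordApproxEigenvalue lam τ i) (v : EuclideanSpace ℝ (Fin n)) :
    matSeminorm (coordApprox Q lam τ)⁻¹ v ^ 2 =
      ∑ i, (Qᵀ *ᵥ v.ofLp) i ^ 2 / coordApproxEigenvalue lam τ i := by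
  have hpsd : (coordApprox Q lam τ)⁻¹.PosSemidef := by
    rw [coordApprox_inv hQ fun i => (hpos i).ne']
    exact (PosSemidef.diagonal fun i => (inv_pos.mpr (hpos i)).le).mul_mul_conjTranspose_same Q
  rw [matSeminorm_sq hpsd, coordApprox_inv hQ fun i => (hpos i).ne', ← mulVec_mulVec,
    ← mulVec_mulVec, dotProduct_mulVec, ← mulVec_transpose]
  refine sum_congr rfl fun i _ => ?_
  rw [mulVec_diagonal]
  ring

theorem esymm_le_coordApproxEigenvalue_mul (hlam : ∀ i, 0 ≤ lam i) (k : ℕ) (i : Fin n) :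
    (univ.val.map lam).esymm (k + 1) ≤
      coordApproxEigenvalue lam (k + 1) i * ((univ.erase i).val.map lam).esymm k := by
  let p : Fin n := ⟨min i.val k, lt_of_le_of_lt (min_le_left _ _) i.isLt⟩
  let tail : Finset (Fin n) := {j | k + 1 ≤ j.val}
  have hp : p ∉ tail := by
    simp [p, tail]
  have hi : i ∈ insert p tail := by
    simp only [mem_insert, mem_filter_univ, p, tail, Fin.ext_iff]
    omega
  have hcard : #(univ \ insert p tail) ≤ k := by
    have hsubset : (univ \ insert p tail).map Fin.valEmbedding ⊆ (range (k + 1)).erase p.val := by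
      intro j hj
      simp only [mem_map, mem_sdiff, mem_insert, tail, mem_filter_univ, Fin.ext_iff,
        Fin.valEmbedding_apply] at hj
      simp only [mem_erase, mem_range]
      grind
    have h := card_le_card hsubset
    rwa [card_map, card_erase_of_mem (by simp [p]), card_range, Nat.add_sub_cancel] at h
  have h := esymm_succ_le hlam univ hcard hi
  rwa [sum_insert hp] at h

theorem coordApproxEigenvalue_pos (hlam : ∀ i, 0 ≤ lam i) {k : ℕ}
    (hk : 0 < (univ.val.map lam).esymm (k + 1)) (i : Fin n) :
    0 < coordApproxEigenvalue lam (k + 1) i :=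
  (coordApproxEigenvalue_nonneg hlam (k + 1) i).lt_of_ne' <| left_ne_zero_of_mul
    (hk.trans_le (esymm_le_coordApproxEigenvalue_mul hlam k i)).ne'

end SpectralDecomposition

section VolumeSampling

variable {Ω : Type*} [MeasurableSpace Ω] {μ : Measure Ω}

theorem integrable_comp_of_finite {α E : Type*} [Finite α] [NormedAddCommGroup E]
    [IsFiniteMeasure μ] {S : Ω → α} (hS : Measurable[_, ⊤] S) (F : α → E) :
    Integrable (fun ω => F (S ω)) μ :=
  let _ : MeasurableSpace α := ⊤
  Integrable.of_finite.comp_measurable hS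

theorem integral_comp_eq_sum {α E : Type*} [Fintype α] [NormedAddCommGroup E] [NormedSpace ℝ E]
    [CompleteSpace E] [IsFiniteMeasure μ] {S : Ω → α} (hS : Measurable[_, ⊤] S) (F : α → E) :
    ∫ ω, F (S ω) ∂μ = ∑ a, μ.real {ω | S ω = a} • F a := by
  let _ : MeasurableSpace α := ⊤
  have hF : Integrable F (μ.map S) := .of_finite
  rw [← integral_map hS.aemeasurable hF.aestronglyMeasurable, integral_fintype hF]
  refine sum_congr rfl fun a _ => ?_
  rw [map_measureReal_apply hS (measurableSet_singleton a)]
  rfl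

variable {n τ : ℕ} {B Q : Matrix (Fin n) (Fin n) ℝ} {S₀ : Ω → CoordSubset n τ}

theorem sum_coordSubset {M : Type*} [AddCommMonoid M] (F : Finset (Fin n) → M) :
    ∑ S : CoordSubset n τ, F S.val = ∑ S ∈ univ.powersetCard τ, F S :=
  (sum_subtype _ (fun _ => mem_powersetCard_univ) F).symm

theorem IsVolumeSampling.integral_eq [IsFiniteMeasure μ] (hS₀ : IsVolumeSampling μ B S₀)
    (F : Finset (Fin n) → ℝ) :
    ∫ ω, F (S₀ ω).val ∂μ =
      (∑ S ∈ univ.powersetCard τ, (principalSub B S).det * F S) / sumPrincipalMinors B τ := by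
  rw [integral_comp_eq_sum hS₀.measurable fun S => F S.val, ← sum_coordSubset, sum_div]
  refine sum_congr rfl fun S _ => ?_
  rw [hS₀.prob_eq, sum_coordSubset fun S => (principalSub B S).det, smul_eq_mul, div_mul_eq_mul_div]
  rfl

theorem IsVolumeSampling.sumPrincipalMinors_pos [IsProbabilityMeasure μ]
    (hS₀ : IsVolumeSampling μ B S₀) (hB : B.PosSemidef) : 0 < sumPrincipalMinors B τ := by
  have hnonneg : 0 ≤ sumPrincipalMinors B τ := sum_nonneg fun s _ => (hB.submatrix _).det_nonneg
  have htotal : 1 = sumPrincipalMinors B τ / sumPrincipalMinors B τ := by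
    simpa [sumPrincipalMinors, principalSub] using hS₀.integral_eq fun _ => 1
  refine hnonneg.lt_of_ne' fun hzero => ?_
  rw [hzero, div_zero] at htotal
  exact one_ne_zero htotal

theorem IsVolumeSampling.integral_blockDecrementSq [IsFiniteMeasure μ] {k : ℕ}
    {S₀ : Ω → CoordSubset n (k + 1)} {lam : Fin n → ℝ} (hB : (Q * diagonal lam * Qᵀ).PosSemidef)
    (hQ : Q * Qᵀ = 1) (hS₀ : IsVolumeSampling μ (Q * diagonal lam * Qᵀ) S₀)
    {g : EuclideanSpace ℝ (Fin n)} (hg : ∀ v, (Q * diagonal lam * Qᵀ) *ᵥ v = 0 → g.ofLp ⬝ᵥ v = 0) :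
    ∫ ω, blockDecrementSq (Q * diagonal lam * Qᵀ) g (S₀ ω).val ∂μ =
      (∑ i, (Qᵀ *ᵥ g.ofLp) i ^ 2 * ((univ.erase i).val.map lam).esymm k) /
        (univ.val.map lam).esymm (k + 1) := by
  rw [hS₀.integral_eq, sumPrincipalMinors_conj (mul_eq_one_comm.mp hQ), sumPrincipalMinors_diagonal]
  congr 1
  have hadj (S : Finset (Fin n)) : (principalSub (Q * diagonal lam * Qᵀ) S).det *
        blockDecrementSq (Q * diagonal lam * Qᵀ) g S =
      subvec g S ⬝ᵥ ((principalSub (Q * diagonal lam * Qᵀ) S).adjugate *ᵥ subvec g S) :=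
    det_mul_dotProduct_inv_mulVec _ _ _ (subvec_dotProduct_eq_zero hB hg S)
  simp only [hadj, sq]
  have hsum := sum_dotProduct_adjugate_conj_diagonal hQ lam g.ofLp g.ofLp k
  rwa [← mulVec_transpose] at hsum

theorem IsVolumeSampling.le_integral_blockDecrementSq [IsProbabilityMeasure μ]
    (hS₀ : IsVolumeSampling μ B S₀) (hB : B.PosSemidef) (hτ : 1 ≤ τ) {lam : Fin n → ℝ}
    (hQ : Q * Qᵀ = 1) (hBQ : B = Q * diagonal lam * Qᵀ) {g : EuclideanSpace ℝ (Fin n)}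
    (hg : ∀ v, B *ᵥ v = 0 → g.ofLp ⬝ᵥ v = 0) :
    matSeminorm (coordApprox Q lam τ)⁻¹ g ^ 2 ≤ ∫ ω, blockDecrementSq B g (S₀ ω).val ∂μ := by
  subst hBQ
  obtain ⟨k, rfl⟩ := Nat.exists_eq_add_of_le' hτ
  have hlam := nonneg_of_posSemidef_conj_diagonal hB hQ
  have hesymm : 0 < (univ.val.map lam).esymm (k + 1) := by
    rw [← sumPrincipalMinors_diagonal, ← sumPrincipalMinors_conj (mul_eq_one_comm.mp hQ)]
    exact hS₀.sumPrincipalMinors_pos hB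
  have hpos := coordApproxEigenvalue_pos hlam hesymm
  rw [hS₀.integral_blockDecrementSq hB hQ hg, matSeminorm_coordApprox_inv_sq hQ hpos, sum_div]
  refine sum_le_sum fun i _ => ?_
  rw [div_le_div_iff₀ (hpos i) hesymm, mul_assoc, mul_comm (Multiset.esymm _ k)]
  gcongr
  exact esymm_le_coordApproxEigenvalue_mul hlam k i

end VolumeSampling

end RCDVS

open Matrix in
theorem lemma3p5_general {n τ : ℕ} (B : Matrix (Fin n) (Fin n) ℝ) (hB : B.PosSemidef)
    (hτ : 1 ≤ τ) (f : EuclideanSpace ℝ (Fin n) → ℝ) (hf : RCDVS.IsOneSmooth f B)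
    (x₀ : EuclideanSpace ℝ (Fin n))
    (hker : ∀ v, B *ᵥ v = 0 → (gradient f x₀).ofLp ⬝ᵥ v = 0)
    {Ω : Type*} [MeasurableSpace Ω] (μ : Measure Ω) [IsProbabilityMeasure μ]
    (S₀ : Ω → RCDVS.CoordSubset n τ) (hS₀ : RCDVS.IsVolumeSampling μ B S₀)
    (Q : Matrix (Fin n) (Fin n) ℝ) (lam : Fin n → ℝ) (hQ : Q ∈ orthogonalGroup (Fin n) ℝ)
    (hBQ : B = Q * diagonal lam * Qᵀ) :
    (∀ ω, f (RCDVS.step f B x₀ (S₀ ω).val) ≤ f x₀) ∧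
    Integrable (fun ω => f (RCDVS.step f B x₀ (S₀ ω).val)) μ ∧
    f x₀ - ∫ ω, f (RCDVS.step f B x₀ (S₀ ω).val) ∂μ ≥
      1 / 2 * RCDVS.matSeminorm (RCDVS.coordApprox Q lam τ)⁻¹ (gradient f x₀) ^ 2 := by
  have hint (F : Finset (Fin n) → ℝ) : Integrable (fun ω => F (S₀ ω).val) μ :=
    RCDVS.integrable_comp_of_finite hS₀.measurable fun S => F S.val
  have hstep (S) := hf.step_le hB x₀ S
  refine ⟨fun ω => ?_, hint fun S => f (RCDVS.step f B x₀ S), ?_⟩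
  · linarith [hstep (S₀ ω).val, RCDVS.blockDecrementSq_nonneg hB (gradient f x₀) (S₀ ω).val]
  set D := RCDVS.blockDecrementSq B (gradient f x₀)
  have hexp : ∫ ω, f (RCDVS.step f B x₀ (S₀ ω).val) ∂μ ≤ f x₀ - 1 / 2 * ∫ ω, D (S₀ ω).val ∂μ :=
    calc ∫ ω, f (RCDVS.step f B x₀ (S₀ ω).val) ∂μ
        ≤ ∫ ω, (f x₀ - 1 / 2 * D (S₀ ω).val) ∂μ :=
          integral_mono (hint fun S => f (RCDVS.step f B x₀ S))
            (hint fun S => f x₀ - 1 / 2 * D S) fun ω => hstep (S₀ ω).val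
      _ = f x₀ - 1 / 2 * ∫ ω, D (S₀ ω).val ∂μ := by
          rw [integral_sub (integrable_const _) ((hint D).const_mul _), integral_const_mul,
            integral_const, probReal_univ, one_smul]
  linarith [hS₀.le_integral_blockDecrementSq hB hτ ((mem_orthogonalGroup_iff _ ℝ).mp hQ) hBQ hker]

theorem lemma3p5 {n τ : ℕ} (B : Matrix (Fin n) (Fin n) ℝ) (hB : B.PosSemidef)
    (hτ : 1 ≤ τ) (hτB : τ ≤ B.rank)
    (f : EuclideanSpace ℝ (Fin n) → ℝ) (hf : RCDVS.IsOneSmooth f B)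
    (hbdd : BddBelow (Set.range f))
    (x₀ : EuclideanSpace ℝ (Fin n))
    {Ω : Type*} [MeasurableSpace Ω] (μ : Measure Ω) [IsProbabilityMeasure μ]
    (S₀ : Ω → RCDVS.CoordSubset n τ) (hS₀ : RCDVS.IsVolumeSampling μ B S₀)
    (Q : Matrix (Fin n) (Fin n) ℝ) (lam : Fin n → ℝ) (hQ : RCDVS.IsSpectralDecomp B Q lam) :
    (∀ᵐ ω ∂μ, f (RCDVS.step f B x₀ (S₀ ω).val) ≤ f x₀) ∧
    Integrable (fun ω => f (RCDVS.step f B x₀ (S₀ ω).val)) μ ∧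
    f x₀ - ∫ ω, f (RCDVS.step f B x₀ (S₀ ω).val) ∂μ ≥
      1 / 2 * RCDVS.matSeminorm (RCDVS.coordApprox Q lam τ)⁻¹ (gradient f x₀) ^ 2 :=
  have ⟨hle, hint, hdecr⟩ := lemma3p5_general B hB hτ f hf x₀
    (fun _ => hf.gradient_dotProduct_eq_zero hB hbdd x₀) μ S₀ hS₀ Q lam hQ.orthogonal hQ.eq
  ⟨.of_forall hle, hint, hdecr⟩
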